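/- **Theorem (nodal–magnetic theorem with explicit Hessian).** Let $G=(V,E)$ be a finite simple connected graph on $n=|V|$ vertices whose edges carry an arbitrary fixed orientation, $r\to s$. Let $H$ be a real symmetric $V\times V$ matrix strictly supported on $G$, that is, for $r\neq s$ one has $H_{rs}\neq 0$ if and only if $r$ and $s$ are adjacent (the diagonal is arbitrary). Let $\lambda_1(H)\le\dots\le\lambda_n(H)$ be its eigenvalues, suppose that $\lambda_k(H)$ is simple, and let $\psi\in\mathbb R^V$ be a normalized eigenvector, $H\psi=\lambda_k(H)\psi$, $\sum_r\psi_r^2=1$, with no zero entries. Let $\Phi$ be the diagonal matrix on $\mathbb R^E$ with entries $\Phi_{(r\to s),(r\to s)}=-\psi_rH_{rs}\psi_s$. Let $d:\mathbb R^V\to\mathbb R^E$, $(d\theta)_{(r\to s)}=\theta_s-\theta_r$, and let $Z\subset\mathbb R^E$ be the cycle space, the set of all $f$ such that at every vertex the sum of $f$ over the incoming edges equals the sum over the outgoing edges. Identify $C^1(G,\mathbb R)$ with $\mathbb R^E$. For $\alpha\in C^1(G,\mathbb R)$ put $\alpha_{rs}=\alpha(r\to s)$ if $r\to s$ is an oriented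 edge, $\alpha_{rs}=-\alpha(s\to r)$ if $s\to r$ is one, and $\alpha_{rs}=0$ otherwise. Let $H_\alpha$ be the Hermitian matrix with entries $(H_\alpha)_{rs}=e^{i\alpha_{rs}}H_{rs}$, and let $\Lambda(\alpha)=\lambda_k(H_\alpha)$ be its $k$-th smallest eigenvalue, counted with multiplicity. Then $\Lambda:C^1(G,\mathbb R)\to\mathbb R$ is twice continuously differentiable near $\alpha=0$, and $\alpha=0$ is a critical point of $\Lambda$. Moreover $C^1(G,\mathbb R)=\Phi^{-1}Z\oplus d\mathbb R^V$, and with respect to this decomposition the Hessian of $\Lambda$ at $0$ is the bilinear form $$\operatorname{Hess}\Lambda=2[\Phi]_{\Phi^{-1}Z}\oplus \mathbf 0_{d\mathbb R^V},$$ where $[\Phi]_{\Phi^{-1}Z}$ is the restriction of the bilinear form $(\alpha,\beta)\mapsto\sum_{e\in E}\alpha_e\Phi_{ee}\beta_e$ to $\Phi^{-1}Z$; that is, $\operatorname{Hess}\Lambda(z+d\theta,\,z'+d\theta')=2\sum_{e\in E}z_e\Phi_{ee}z'_e$ for all $z,z'\in\Phi^{-1}Z$ and $\theta,\theta'\in\mathbb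 R^V$. Consequently the Morse index $n_-(\operatorname{Hess}\Lambda)$, the maximal dimension of a subspace on which this form is negative definite, is $$n_-(\operatorname{Hess}\Lambda)=\#\{(r\to s)\in E:\psi_rH_{rs}\psi_s>0\}-(k-1).$$ -/

import Mathlib

open scoped Matrix

/-- An orientation of a simple graph `G`: a set of directed edges containing, for every edge
`{r, s}` of `G`, exactly one of the pairs `(r, s)` (read `r → s`) and `(s, r)`, and nothing else. -/
structure EdgeOrientation {V : Type*} (G : SimpleGraph V) where
  /-- the directed edges -/
  edges : Finset (V × V)
  adj_iff : ∀ r s : V, G.Adj r s ↔ (r, s) ∈ edges ∨ (s, r) ∈ edges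
  asymm : ∀ r s : V, (r, s) ∈ edges → (s, r) ∉ edges

/-- `H` is strictly supported on `G`: off the diagonal, the nonzero entries of `H` are exactly
those at the edges of `G`. The diagonal is unrestricted. -/
def StrictlySupported {V : Type*} (G : SimpleGraph V) (H : Matrix V V ℝ) : Prop :=
  ∀ r s : V, r ≠ s → (H r s ≠ 0 ↔ G.Adj r s)

noncomputable section

/-- The `k`-th eigenvalue of a Hermitian matrix in the increasing enumeration
`λ₁ ≤ λ₂ ≤ ⋯ ≤ λₙ`, with multiplicity, `1 ≤ k ≤ n`
(`eigenvalues₀` is the decreasing enumeration, starting at index `0`). -/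
def kthEigenvalue {V 𝕜 : Type*} [Fintype V] [DecidableEq V] [RCLike 𝕜] {A : Matrix V V 𝕜}
    (hA : A.IsHermitian) (k : ℕ) (hk₁ : 1 ≤ k) (hk : k ≤ Fintype.card V) : ℝ :=
  hA.eigenvalues₀ ⟨Fintype.card V - k, by omega⟩

namespace EdgeOrientation

variable {V : Type*} [DecidableEq V] {G : SimpleGraph V} (D : EdgeOrientation G)

/-- The space `ℝ^E` of real functions on the directed edges; it serves both as the space
`C¹(G, ℝ)` of 1-cochains and as the space `C₁(G, ℝ)` of 1-chains. -/
abbrev EdgeSpace : Type _ := ↥D.edges → ℝ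

/-- The coboundary operator `d : ℝ^V → ℝ^E`, `(dθ)_(r → s) = θ_s - θ_r`. -/
def coboundary : (V → ℝ) →ₗ[ℝ] D.EdgeSpace where
  toFun θ e := θ e.1.2 - θ e.1.1
  map_add' θ η := by ext e; simp only [Pi.add_apply]; ring
  map_smul' c θ := by ext e; simp only [Pi.smul_apply, smul_eq_mul, RingHom.id_apply]; ring

/-- The cycle space `Z ⊆ ℝ^E`: at every vertex, the sum over the incoming edges equals the sum
over the outgoing edges. -/
def cycleSpace : Submodule ℝ D.EdgeSpace where
  carrier := {f | ∀ r : V, ∑ e : ↥D.edges with e.1.2 = r, f e = ∑ e : ↥D.edges with e.1.1 = r, f e}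
  zero_mem' := fun r => by simp
  add_mem' := fun {f g} hf hg r => by
    simp only [Pi.add_apply, Finset.sum_add_distrib, hf r, hg r]
  smul_mem' := fun c f hf r => by
    simp only [Pi.smul_apply, ← Finset.smul_sum, hf r]

/-- The nodal count of `ψ`: the number of directed edges `r → s` with `ψ_r H_{rs} ψ_s > 0`. -/
def nodalCount (H : Matrix V V ℝ) (ψ : V → ℝ) : ℕ :=
  Fintype.card {e : ↥D.edges // 0 < ψ e.1.1 * H e.1.1 e.1.2 * ψ e.1.2}

/-- The diagonal matrix `Φ` on `ℝ^E` with entries `-ψ_r H_{rs} ψ_s` at `r → s`. -/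
def weight (H : Matrix V V ℝ) (ψ : V → ℝ) : Matrix ↥D.edges ↥D.edges ℝ :=
  Matrix.diagonal fun e => -(ψ e.1.1 * H e.1.1 e.1.2 * ψ e.1.2)

/-- The subspace `Φ⁻¹ Z` of `C¹(G, ℝ)`. -/
def gaugeSpace (H : Matrix V V ℝ) (ψ : V → ℝ) : Submodule ℝ D.EdgeSpace :=
  D.cycleSpace.map (Matrix.toLin' (D.weight H ψ)⁻¹)

/-- A 1-cochain as an antisymmetric function of two vertices, vanishing off the edges. -/
def antisym (α : D.EdgeSpace) (r s : V) : ℝ :=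
  if h : (r, s) ∈ D.edges then α ⟨(r, s), h⟩
  else if h : (s, r) ∈ D.edges then -α ⟨(s, r), h⟩
  else 0

theorem antisym_swap (α : D.EdgeSpace) (r s : V) : D.antisym α s r = -D.antisym α r s := by
  have h := D.asymm r s
  unfold antisym
  by_cases h1 : (r, s) ∈ D.edges
  · simp [h1, h h1]
  · by_cases h2 : (s, r) ∈ D.edges <;> simp [h1, h2]

/-- The phase perturbation `H_α` of `H`: `(H_α)_{rs} = exp(i α_{rs}) H_{rs}`. -/
def phaseMatrix (H : Matrix V V ℝ) (α : D.EdgeSpace) : Matrix V V ℂ :=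
  Matrix.of fun r s => Complex.exp (Complex.I * (D.antisym α r s : ℂ)) * (H r s : ℂ)

theorem phaseMatrix_isHermitian {H : Matrix V V ℝ} (hH : H.IsSymm) (α : D.EdgeSpace) :
    (D.phaseMatrix H α).IsHermitian := by
  ext r s
  have h1 : H s r = H r s := hH.apply r s
  simp only [phaseMatrix, Matrix.conjTranspose_apply, Matrix.of_apply, D.antisym_swap α r s,
    star_mul', RCLike.star_def, ← Complex.exp_conj, map_mul, Complex.conj_I, Complex.conj_ofReal,
    h1, Complex.ofReal_neg, map_neg, neg_mul, mul_neg, neg_neg]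

/-- The function `Λ(α) = λ_k(H_α)` on `C¹(G, ℝ)`. -/
def magneticEigenvalue [Fintype V] {H : Matrix V V ℝ} (hH : H.IsSymm) (k : ℕ) (hk₁ : 1 ≤ k)
    (hk : k ≤ Fintype.card V) (α : D.EdgeSpace) : ℝ :=
  kthEigenvalue (D.phaseMatrix_isHermitian hH α) k hk₁ hk

end EdgeOrientation

/-- The Hessian of `f` at `x`, as a bilinear form: the second Fréchet derivative. -/
def hessian {E : Type*} [NormedAddCommGroup E] [NormedSpace ℝ E] (f : E → ℝ) (x : E) :
    LinearMap.BilinForm ℝ E :=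
  (fderiv ℝ (fderiv ℝ f) x).toBilinForm

/-- The Morse index `n₋` of a bilinear form: the maximal dimension of a subspace on which the
form is negative definite. -/
def morseIndex {E : Type*} [AddCommGroup E] [Module ℝ E] (B : LinearMap.BilinForm ℝ E) : ℕ :=
  sigNeg B.toQuadraticMap

/-- The form `B₁ ⊕ B₂` on `E = W ⊕ U`, for bilinear forms `B₁` on `W` and `B₂` on `U`:
`(w + u, w' + u') ↦ B₁(w, w') + B₂(u, u')`. -/
def directSumForm {E : Type*} [AddCommGroup E] [Module ℝ E] {W U : Submodule ℝ E}
    (h : IsCompl W U) (B₁ : LinearMap.BilinForm ℝ W) (B₂ : LinearMap.BilinForm ℝ U) :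
    LinearMap.BilinForm ℝ E :=
  B₁.comp (W.projectionOnto U h) (W.projectionOnto U h) +
    B₂.comp (U.projectionOnto W h.symm) (U.projectionOnto W h.symm)

end

/-! Smoothness: the function `Λ` is continuous by Weyl's inequality and satisfies `det (Λ(α) - H_α)
= 0`. As `λ_k(H)` is a simple root of the characteristic polynomial, the implicit function theorem
makes `Λ` twice continuously differentiable at `0`.

Two symmetries follow from the characteristic polynomial. Since `H_{-α}` is the transpose of `H_α`,
`Λ` is even and `0` is critical. Since `H_{α + dθ}` is unitarily conjugate to `H_α`, `Λ` is
invariant under translation by `dθ`, so `dℝ^V` lies in the kernel of the Hessian.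

The subspace `Φ⁻¹Z` is the `Φ`-orthogonal complement of `dℝ^V`. For `z` in it, the first-order
perturbation of `H` along `z` annihilates `ψ`, so `ψ` solves the eigenvalue equation of `H_{tz}` up
to `O(t²)`. Pairing this residual with a true unit eigenvector and dividing by `t²` gives in the
limit `Hess Λ(z, z) = 2 Φ(z, z)`; polarization does the rest.

For the index, the identity `Φ(dθ, dη) = ⟨ψη, (H - λ)(ψθ)⟩` is decisive. Simplicity of `λ` makes `Φ`
nondegenerate on `dℝ^V`, whence the direct sum, and its negative index there is the number `k - 1`
of eigenvalues below `λ`. On all of `ℝ^E`, `Φ` is diagonal with one negative entry per nodal edge.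
Negative indices add over orthogonal sums, so `Φ⁻¹Z` carries the difference. -/

/-! ### Negative index of inertia of real quadratic forms. -/

section Signature

open QuadraticMap QuadraticForm

variable {M N : Type*} [AddCommGroup M] [Module ℝ M] [FiniteDimensional ℝ M]
  [AddCommGroup N] [Module ℝ N] [FiniteDimensional ℝ N]

/-- A linear map that preserves quadratic forms, injective or not, does not decrease the negative
index of inertia. -/
theorem sigNeg_le_of_comp (Q : QuadraticForm ℝ M) (R : QuadraticForm ℝ N) (g : M →ₗ[ℝ] N)
    (h : ∀ x, R (g x) = Q x) : sigNeg Q ≤ sigNeg R := by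
  obtain ⟨U, hU, hneg⟩ := exists_finrank_eq_sigNeg_and_negDef Q
  have hlt : ∀ x ∈ U, x ≠ 0 → Q x < 0 := fun x hx h0 => by
    have := hneg ⟨x, hx⟩ (by simpa using h0)
    simpa using this
  -- A nonzero kernel vector in `U` would have `Q`-value `R 0 = 0`, against negativity.
  have hinj : Function.Injective (g.domRestrict U) := by
    rw [injective_iff_map_eq_zero]
    intro x hx
    by_contra h0
    have h1 := hlt x x.2 (by simpa using h0)
    rw [← h x, ← LinearMap.domRestrict_apply, hx, map_zero] at h1
    exact lt_irrefl _ h1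
  rw [← hU, ← LinearMap.finrank_range_of_inj hinj]
  refine le_sigNeg_of_negDef R ?_
  rintro ⟨_, x, rfl⟩ hx
  have hx0 : (x : M) ≠ 0 := by
    intro h0
    apply hx
    ext
    simp [h0]
  simpa [h] using hlt x x.2 hx0

/-- A linear section of `g` gives the reverse inequality. Thus directions in the kernel of `g` do
not affect the index. -/
theorem sigNeg_eq_of_comp_surjective (Q : QuadraticForm ℝ M) (R : QuadraticForm ℝ N)
    (g : M →ₗ[ℝ] N) (hg : Function.Surjective g) (h : ∀ x, R (g x) = Q x) :
    sigNeg Q = sigNeg R := by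
  obtain ⟨s, hs⟩ := g.exists_rightInverse_of_surjective (LinearMap.range_eq_top.mpr hg)
  refine le_antisymm (sigNeg_le_of_comp Q R g h) (sigNeg_le_of_comp R Q s fun x => ?_)
  rw [← h, ← LinearMap.comp_apply, hs, LinearMap.id_apply]

theorem sigNeg_prod (Q : QuadraticForm ℝ M) (R : QuadraticForm ℝ N) :
    sigNeg (Q.prod R) = sigNeg Q + sigNeg R := by
  have : Invertible (2 : ℝ) := invertibleOfNonzero two_ne_zero
  obtain ⟨v, hv⟩ := Q.equivalent_weightedSumSquares
  obtain ⟨w, hw⟩ := R.equivalent_weightedSumSquares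
  have he : (Q.prod R).Equivalent (weightedSumSquares ℝ (Sum.elim v w)) := by
    refine (hv.prod hw).trans ⟨⟨(LinearEquiv.sumArrowLequivProdArrow _ _ ℝ ℝ).symm, ?_⟩⟩
    rintro ⟨x, y⟩
    simp [weightedSumSquares_apply]
  rw [sigNeg_of_equiv_weightedSumSquares he, sigNeg_of_equiv_weightedSumSquares hv,
    sigNeg_of_equiv_weightedSumSquares hw]
  have : {i | Sum.elim v w i < 0} = Sum.inl '' {i | v i < 0} ∪ Sum.inr '' {i | w i < 0} := by
    ext (i | i) <;> simp
  rw [this, Set.ncard_union_eq, Set.ncard_image_of_injective _ Sum.inl_injective,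
    Set.ncard_image_of_injective _ Sum.inr_injective]
  rw [Set.disjoint_left]
  rintro _ ⟨a, _, rfl⟩ ⟨b, _, h⟩
  cases h

/-- Additivity of the negative index of inertia over an orthogonal direct sum. -/
theorem sigNeg_eq_add_of_isCompl (B : LinearMap.BilinForm ℝ M) {W U : Submodule ℝ M}
    (h : IsCompl W U) (hWU : ∀ w ∈ W, ∀ u ∈ U, B w u = 0 ∧ B u w = 0) :
    sigNeg B.toQuadraticMap =
      sigNeg (B.toQuadraticMap.restrict W) + sigNeg (B.toQuadraticMap.restrict U) := by
  rw [← sigNeg_prod]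
  refine (Equivalent.sigNeg_eq ⟨⟨W.prodEquivOfIsCompl U h, ?_⟩⟩).symm
  rintro ⟨w, u⟩
  simp [(hWU w w.2 u u.2).1, (hWU w w.2 u u.2).2]

/-- The Morse index of `2 B|_W ⊕ 0` is that of `B|_W`. -/
theorem morseIndex_directSumForm_two_smul (B : LinearMap.BilinForm ℝ M) {W U : Submodule ℝ M}
    (h : IsCompl W U) :
    morseIndex (directSumForm h ((2 : ℝ) • B.restrict W) 0) =
      sigNeg (B.toQuadraticMap.restrict W) := by
  have h2 : Real.sqrt 2 * Real.sqrt 2 = 2 := Real.mul_self_sqrt (by norm_num)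
  -- The factor `√2` absorbs the `2`: the scaled projection pulls `B|_W` back to `2 B|_W ⊕ 0`.
  refine sigNeg_eq_of_comp_surjective _ _ (Real.sqrt 2 • W.projectionOnto U h) ?_ ?_
  · intro w
    refine ⟨(Real.sqrt 2)⁻¹ • (w : M), ?_⟩
    rw [LinearMap.smul_apply, map_smul, Submodule.projectionOnto_apply_left, smul_smul,
      mul_inv_cancel₀ (by positivity), one_smul]
  · intro x
    simp only [restrict_apply, LinearMap.smul_apply, Submodule.coe_smul,
      LinearMap.BilinMap.toQuadraticMap_apply, directSumForm, LinearMap.add_apply,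
      LinearMap.BilinForm.comp_apply, LinearMap.zero_apply, map_smul, smul_eq_mul, add_zero,
      LinearMap.BilinForm.restrict_apply, LinearMap.domRestrict_apply]
    rw [← mul_assoc, h2]

end Signature

/-! ### Ordered eigenvalues, their continuity, and simplicity. -/

section Spectrum

open Module RCLike Filter Topology

/-- Monotonicity of the ordered eigenvalues of self-adjoint operators (Weyl's inequality). -/
theorem LinearMap.IsSymmetric.eigenvalues_le_add {𝕜 E : Type*} [RCLike 𝕜] [NormedAddCommGroup E]
    [InnerProductSpace 𝕜 E] [FiniteDimensional 𝕜 E] {n : ℕ} {T S : E →ₗ[𝕜] E}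
    (hT : T.IsSymmetric) (hS : S.IsSymmetric) (hn : finrank 𝕜 E = n) {ε : ℝ}
    (h : ∀ x, re (inner 𝕜 x (T x)) ≤ re (inner 𝕜 x (S x)) + ε * ‖x‖ ^ 2) (i : Fin n) :
    hT.eigenvalues hn i ≤ hS.eigenvalues hn i + ε := by
  have hform : ∀ {A : E →ₗ[𝕜] E} (hA : A.IsSymmetric) (x : E), re (inner 𝕜 x (A x)) =
      ∑ j, hA.eigenvalues hn j * ‖inner 𝕜 (hA.eigenvectorBasis hn j) x‖ ^ 2 := by
    intro A hA x
    rw [← (hA.eigenvectorBasis hn).sum_inner_mul_inner, map_sum]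
    refine Finset.sum_congr rfl fun j _ => ?_
    rw [← hA, hA.apply_eigenvectorBasis, inner_smul_left, conj_ofReal, mul_left_comm,
      re_ofReal_mul, ← inner_conj_symm x, RCLike.conj_mul, ← ofReal_pow, ofReal_re]
  have hnorm : ∀ (b : OrthonormalBasis (Fin n) 𝕜 E) (x : E),
      ‖x‖ ^ 2 = ∑ j, ‖inner 𝕜 (b j) x‖ ^ 2 := fun b x => (b.sum_sq_norm_inner_right x).symm
  have hspan : ∀ (b : OrthonormalBasis (Fin n) 𝕜 E) (s : Finset (Fin n)),
      ∀ x ∈ Submodule.span 𝕜 (b '' s), ∀ j ∉ s, inner 𝕜 (b j) x = 0 := by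
    intro b s x hx j hj
    induction hx using Submodule.span_induction with
    | mem x hx =>
      obtain ⟨l, hl, rfl⟩ := hx
      exact b.orthonormal.2 (by rintro rfl; exact hj hl)
    | zero => simp
    | add x y _ _ hx hy => simp [inner_add_right, hx, hy]
    | smul a x _ hx => simp [inner_smul_right, hx]
  have hrank : ∀ (b : OrthonormalBasis (Fin n) 𝕜 E) (s : Finset (Fin n)),
      finrank 𝕜 (Submodule.span 𝕜 (b '' s)) = s.card := by
    classical
    intro b s
    have := finrank_span_finset_eq_card (R := 𝕜) (s := s.image b) ?_
    · rw [Finset.card_image_of_injective _ b.orthonormal.linearIndependent.injective,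
        Finset.coe_image] at this
      exact this
    · have := b.orthonormal.linearIndependent.linearIndepOn_id
      exact this.mono (by simp)
  set bT := hT.eigenvectorBasis hn
  set bS := hS.eigenvectorBasis hn
  -- Eigenvalues decrease with the index: on `P` the form of `T` is at least its `i`-th eigenvalue,
  -- on `R` that of `S` at most its `i`-th. The dimensions `i + 1` and `n - i` exceed `n` in total,
  -- so `P` and `R` share a nonzero vector.
  set P := Submodule.span 𝕜 (bT '' (Finset.Iic i : Finset (Fin n)))
  set R := Submodule.span 𝕜 (bS '' (Finset.Ici i : Finset (Fin n)))
  have hPR : ¬ Disjoint P R := by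
    intro hd
    have := Submodule.finrank_add_finrank_le_of_disjoint hd
    rw [hrank, hrank, hn, Fin.card_Iic, Fin.card_Ici] at this
    omega
  rw [Submodule.disjoint_def] at hPR
  push Not at hPR
  obtain ⟨x, hxP, hxR, hx0⟩ := hPR
  have hlow : hT.eigenvalues hn i * ‖x‖ ^ 2 ≤ re (inner 𝕜 x (T x)) := by
    rw [hform hT, hnorm bT, Finset.mul_sum]
    refine Finset.sum_le_sum fun j _ => ?_
    by_cases hj : j ∈ Finset.Iic i
    · exact mul_le_mul_of_nonneg_right (hT.eigenvalues_antitone hn (Finset.mem_Iic.mp hj))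
        (sq_nonneg _)
    · simp [bT, hspan bT _ x hxP j hj]
  have hup : re (inner 𝕜 x (S x)) ≤ hS.eigenvalues hn i * ‖x‖ ^ 2 := by
    rw [hform hS, hnorm bS, Finset.mul_sum]
    refine Finset.sum_le_sum fun j _ => ?_
    by_cases hj : j ∈ Finset.Ici i
    · exact mul_le_mul_of_nonneg_right (hS.eigenvalues_antitone hn (Finset.mem_Ici.mp hj))
        (sq_nonneg _)
    · simp [bS, hspan bS _ x hxR j hj]
  have hpos : 0 < ‖x‖ ^ 2 := by positivity
  refine le_of_mul_le_mul_right ?_ hpos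
  rw [add_mul]
  linarith [h x]

variable {V : Type*} [Fintype V] [DecidableEq V]

theorem kthEigenvalue_le_add_norm {A B : Matrix V V ℂ} (hA : A.IsHermitian) (hB : B.IsHermitian)
    (k : ℕ) (hk₁ : 1 ≤ k) (hk : k ≤ Fintype.card V) :
    kthEigenvalue hA k hk₁ hk ≤
      kthEigenvalue hB k hk₁ hk + ‖Matrix.toEuclideanCLM (𝕜 := ℂ) (A - B)‖ := by
  refine LinearMap.IsSymmetric.eigenvalues_le_add _ _ _ (fun x => ?_) _
  have h1 : Matrix.toEuclideanLin A x = Matrix.toEuclideanLin B x +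
      Matrix.toEuclideanCLM (𝕜 := ℂ) (A - B) x := by
    rw [map_sub]
    simp only [_root_.sub_apply]
    exact (add_sub_cancel _ _).symm
  rw [h1, inner_add_right, map_add]
  gcongr
  calc re (inner ℂ x (Matrix.toEuclideanCLM (𝕜 := ℂ) (A - B) x))
      ≤ ‖x‖ * ‖Matrix.toEuclideanCLM (𝕜 := ℂ) (A - B) x‖ := re_inner_le_norm _ _
    _ ≤ ‖x‖ * (‖Matrix.toEuclideanCLM (𝕜 := ℂ) (A - B)‖ * ‖x‖) := by
        gcongr; exact ContinuousLinearMap.le_opNorm _ _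
    _ = _ := by ring

theorem continuous_kthEigenvalue {X : Type*} [TopologicalSpace X] {A : X → Matrix V V ℂ}
    (hA : ∀ x, (A x).IsHermitian) (hc : Continuous A) (k : ℕ) (hk₁ : 1 ≤ k)
    (hk : k ≤ Fintype.card V) : Continuous fun x => kthEigenvalue (hA x) k hk₁ hk := by
  have hlin : Continuous fun C : Matrix V V ℂ => Matrix.toEuclideanCLM (𝕜 := ℂ) C :=
    LinearMap.continuous_of_finiteDimensional
      (Matrix.toEuclideanCLM (n := V) (𝕜 := ℂ)).toAlgEquiv.toLinearMap
  rw [continuous_iff_continuousAt]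
  intro a
  have hn : Tendsto (fun x => ‖Matrix.toEuclideanCLM (𝕜 := ℂ) (A x - A a)‖) (𝓝 a) (𝓝 0) := by
    have : Continuous fun x => ‖Matrix.toEuclideanCLM (𝕜 := ℂ) (A x - A a)‖ :=
      (hlin.comp (hc.sub continuous_const)).norm
    simpa using this.tendsto a
  refine tendsto_iff_dist_tendsto_zero.mpr (squeeze_zero (fun _ => dist_nonneg) (fun x => ?_) hn)
  rw [Real.dist_eq, abs_le]
  have h1 := kthEigenvalue_le_add_norm (hA x) (hA a) k hk₁ hk
  have h2 := kthEigenvalue_le_add_norm (hA a) (hA x) k hk₁ hk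
  rw [← neg_sub (A x), map_neg, norm_neg] at h2
  constructor <;> linarith

/-- The ordered eigenvalues are the sorted roots of the characteristic polynomial; both symmetries
of `Λ` are deduced through this. -/
theorem kthEigenvalue_congr {A B : Matrix V V ℂ} (hA : A.IsHermitian) (hB : B.IsHermitian)
    (h : A.charpoly = B.charpoly) (k : ℕ) (hk₁ : 1 ≤ k) (hk : k ≤ Fintype.card V) :
    kthEigenvalue hA k hk₁ hk = kthEigenvalue hB k hk₁ hk := by
  have : hA.eigenvalues₀ = hB.eigenvalues₀ := by
    simp_rw [← List.ofFn_inj, ← Matrix.IsHermitian.sort_roots_charpoly_eq_eigenvalues₀, h]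
  rw [kthEigenvalue, kthEigenvalue, this]

/-- The ordered eigenvalues of a real symmetric matrix do not change when it is regarded as a
complex matrix. -/
theorem kthEigenvalue_map_ofReal {A : Matrix V V ℝ} {B : Matrix V V ℂ} (hA : A.IsHermitian)
    (hB : B.IsHermitian) (h : B = A.map Complex.ofRealHom) (k : ℕ) (hk₁ : 1 ≤ k)
    (hk : k ≤ Fintype.card V) :
    kthEigenvalue hB k hk₁ hk = kthEigenvalue hA k hk₁ hk := by
  have : hB.eigenvalues₀ = hA.eigenvalues₀ := by
    simp_rw [← List.ofFn_inj, ← Matrix.IsHermitian.sort_roots_charpoly_eq_eigenvalues₀]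
    rw [h, Matrix.charpoly_map, hA.splits_charpoly.roots_map, Multiset.map_map]
    congr 1
  rw [kthEigenvalue, kthEigenvalue, this]

theorem exists_eigenvalues_eq_kthEigenvalue {𝕜 : Type*} [RCLike 𝕜] {A : Matrix V V 𝕜}
    (hA : A.IsHermitian) (k : ℕ) (hk₁ : 1 ≤ k) (hk : k ≤ Fintype.card V) :
    ∃ v, hA.eigenvalues v = kthEigenvalue hA k hk₁ hk := 
  ⟨Fintype.equivOfCardEq (Fintype.card_fin _) ⟨Fintype.card V - k, by omega⟩,
    by simp [kthEigenvalue, Matrix.IsHermitian.eigenvalues]⟩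

/-- The number of eigenvalues, with multiplicity, below a simple `λ_k` is `k - 1`. -/
theorem ncard_eigenvalues_lt {A : Matrix V V ℝ} (hA : A.IsHermitian) (k : ℕ) (hk₁ : 1 ≤ k)
    (hk : k ≤ Fintype.card V) {lam : ℝ} (hlam : lam = kthEigenvalue hA k hk₁ hk)
    (hinj : ∀ i j, hA.eigenvalues i = lam → hA.eigenvalues j = lam → i = j) :
    {i | hA.eigenvalues i < lam}.ncard = k - 1 := by
  set e := Fintype.equivOfCardEq (α := Fin (Fintype.card V)) (β := V) (Fintype.card_fin _)
  have hev : ∀ i, hA.eigenvalues (e i) = hA.eigenvalues₀ i := fun i => by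
    simp [e, Matrix.IsHermitian.eigenvalues]
  set i₀ : Fin (Fintype.card V) := ⟨Fintype.card V - k, by omega⟩ with hi₀
  have h0 : hA.eigenvalues₀ i₀ = lam := hlam.symm
  -- In the decreasing enumeration from `0`, `λ_k` has index `n - k`. The `k - 1` later eigenvalues
  -- are strictly smaller, because `lam` occurs only once.
  have hset : {i | hA.eigenvalues i < lam} = e '' (Finset.Ioi i₀ : Finset _) := by
    ext i
    obtain ⟨i, rfl⟩ := e.surjective i
    simp only [Set.mem_ofPred_eq, hev, Finset.coe_Ioi, EmbeddingLike.apply_eq_iff_eq, Set.mem_image,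
      Set.mem_Ioi, exists_eq_right]
    constructor
    · intro h
      by_contra! hle
      have := hA.eigenvalues₀_antitone hle
      linarith
    · intro h
      refine lt_of_le_of_ne (h0 ▸ hA.eigenvalues₀_antitone h.le) fun h1 => h.ne' ?_
      exact e.injective (hinj _ _ ((hev _).trans h1) ((hev _).trans h0))
  rw [hset, Set.ncard_image_of_injective _ e.injective, Set.ncard_coe_finset, Fin.card_Ioi]
  simp only [hi₀]
  omega

/-- If an eigenspace is a line, the corresponding eigenvalue occurs at most once. -/
theorem eigenvalues_unique_of_finrank_eq_one {A : Matrix V V ℝ} (hA : A.IsHermitian) {lam : ℝ}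
    (hsimple : finrank ℝ (End.eigenspace (Matrix.toLin' A) lam) = 1) (i j : V)
    (hi : hA.eigenvalues i = lam) (hj : hA.eigenvalues j = lam) : i = j := by
  by_contra hij
  have hmem : ∀ l, hA.eigenvalues l = lam →
      (hA.eigenvectorBasis l).ofLp ∈ End.eigenspace (Matrix.toLin' A) lam := by
    intro l hl
    rw [End.mem_eigenspace_iff, Matrix.toLin'_apply, hA.mulVec_eigenvectorBasis, hl]
  obtain ⟨v, hv⟩ := finrank_le_one_iff.mp hsimple.le
  obtain ⟨a, ha⟩ := hv ⟨_, hmem i hi⟩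
  obtain ⟨b, hb⟩ := hv ⟨_, hmem j hj⟩
  have ha' : WithLp.toLp 2 (a • (v : V → ℝ)) = hA.eigenvectorBasis i := by
    rw [← Submodule.coe_smul, ha]
  have hb' : WithLp.toLp 2 (b • (v : V → ℝ)) = hA.eigenvectorBasis j := by
    rw [← Submodule.coe_smul, hb]
  rw [WithLp.toLp_smul] at ha' hb'
  have h1 : inner ℝ (hA.eigenvectorBasis i) (hA.eigenvectorBasis j) = 0 :=
    hA.eigenvectorBasis.orthonormal.2 hij
  have hi1 := hA.eigenvectorBasis.orthonormal.1 i
  have hj1 := hA.eigenvectorBasis.orthonormal.1 j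
  rw [← ha', ← hb', inner_smul_left, inner_smul_right] at h1
  rw [← ha', norm_smul] at hi1
  rw [← hb', norm_smul] at hj1
  rw [real_inner_self_eq_norm_sq] at h1
  simp only [mul_eq_zero, map_eq_zero, pow_eq_zero_iff, ne_eq, OfNat.ofNat_ne_zero,
    not_false_eq_true] at h1
  rcases h1 with h | h | h
  · simp [h] at hi1
  · simp [h] at hj1
  · simp [h] at hi1

/-- A simple eigenvalue is a simple root of the characteristic polynomial. -/
theorem derivative_charpoly_eval_ne_zero {A : Matrix V V ℝ} (hA : A.IsHermitian) {lam : ℝ}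
    (hex : ∃ i, hA.eigenvalues i = lam)
    (hinj : ∀ i j, hA.eigenvalues i = lam → hA.eigenvalues j = lam → i = j) :
    A.charpoly.derivative.eval lam ≠ 0 := by
  obtain ⟨i, hi⟩ := hex
  have h : A.charpoly = (Polynomial.X - Polynomial.C lam) *
      ∏ j ∈ Finset.univ.erase i, (Polynomial.X - Polynomial.C (hA.eigenvalues j)) := by
    rw [hA.charpoly_eq, ← Finset.mul_prod_erase _ _ (Finset.mem_univ i), hi]
    simp
  rw [h]
  simp only [Polynomial.derivative_mul, Polynomial.derivative_sub, Polynomial.derivative_X,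
    Polynomial.derivative_C, sub_zero, one_mul, Polynomial.eval_add, Polynomial.eval_mul,
    Polynomial.eval_sub, Polynomial.eval_X, Polynomial.eval_C, sub_self, zero_mul, add_zero,
    Polynomial.eval_prod]
  refine Finset.prod_ne_zero_iff.mpr fun j hj h0 => Finset.ne_of_mem_erase hj ?_
  exact hinj _ _ (sub_eq_zero.mp h0).symm hi

end Spectrum

/-! ### Implicit functions, Taylor expansion, and symmetries of the Hessian. -/

section Calculus

open Filter Topology

/-- A continuous solution of an implicit equation whose partial derivative in the unknown does not
vanish is as smooth as the equation. -/
theorem ContinuousAt.contDiffAt_of_implicit {E : Type*} [NormedAddCommGroup E] [NormedSpace ℝ E]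
    [CompleteSpace E] {p : E × ℝ → ℝ} {f : E → ℝ} {a : E} {c : ℝ} (hf : ContinuousAt f a)
    (hp : ContDiff ℝ 2 p) (hd : HasDerivAt (fun t => p (a, t)) c (f a)) (hc : c ≠ 0)
    (h0 : ∀ x, p (x, f x) = 0) : ContDiffAt ℝ 2 f a := by
  have cdf : ContDiffAt ℝ 2 p (a, f a) := hp.contDiffAt
  have hinv : (fderiv ℝ p (a, f a) ∘L .inr ℝ E ℝ).IsInvertible := by
    have h1 : HasFDerivAt p (fderiv ℝ p (a, f a)) (a, f a) :=
      (cdf.differentiableAt (by norm_num)).hasFDerivAt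
    have h2 : HasDerivAt (fun t => p (a, t)) (fderiv ℝ p (a, f a) (0, 1)) (f a) := by
      have h3 : HasDerivAt (fun t : ℝ => ((a, t) : E × ℝ)) (0, 1) (f a) :=
        (hasDerivAt_const _ _).prodMk (hasDerivAt_id _)
      exact HasFDerivAt.comp_hasDerivAt (f a) h1 h3
    have h4 := h2.unique hd
    refine ⟨ContinuousLinearEquiv.unitsEquivAut ℝ (Units.mk0 c hc), ?_⟩
    ext
    simp [h4]
  -- Continuity keeps `(x, f x)` in the neighbourhood where the implicit solution is unique, so `f`
  -- coincides with it near `a`.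
  refine (cdf.contDiffAt_implicitFunction two_ne_zero hinv).congr_of_eventuallyEq ?_
  have hg : Tendsto (fun x => (x, f x)) (𝓝 a) (𝓝 (a, f a)) := by
    rw [nhds_prod_eq]
    exact tendsto_id.prodMk hf
  filter_upwards [hg.eventually (cdf.eventually_apply_eq_iff_implicitFunction two_ne_zero hinv)]
    with x hx
  exact (hx.mp (by rw [h0, h0])).symm

variable {E : Type*} [NormedAddCommGroup E] [NormedSpace ℝ E]

theorem hessian_apply (f : E → ℝ) (x v w : E) :
    hessian f x v w = fderiv ℝ (fderiv ℝ f) x v w := rfl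

/-- Second order Taylor expansion at a critical point, along a line. -/
theorem ContDiffAt.tendsto_div_sq_hessian {f : E → ℝ} (hf : ContDiffAt ℝ 2 f 0)
    (h0 : fderiv ℝ f 0 = 0) (z : E) :
    Tendsto (fun t : ℝ => (f (t • z) - f 0) / t ^ 2) (𝓝[≠] 0) (𝓝 (hessian f 0 z z / 2)) := by
  have hline : ∀ t : ℝ, HasDerivAt (fun t : ℝ => t • z) z t := fun t => by
    simpa using (hasDerivAt_id t).smul_const z
  have htend : Tendsto (fun t : ℝ => t • z) (𝓝 0) (𝓝 0) := by
    simpa using (hline 0).continuousAt.tendsto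
  have hev : ∀ᶠ t : ℝ in 𝓝 0, HasDerivAt (fun t : ℝ => f (t • z) - f 0) (fderiv ℝ f (t • z) z) t := by
    filter_upwards [htend.eventually (hf.eventually (by norm_num))] with t ht
    have h1 := (ht.differentiableAt two_ne_zero).hasFDerivAt
    exact (HasFDerivAt.comp_hasDerivAt (f := fun t : ℝ => t • z) t h1 (hline t)).sub_const (f 0)
  have hsecond : HasDerivAt (fun t : ℝ => fderiv ℝ f (t • z) z) (hessian f 0 z z) 0 := by
    have h1 : DifferentiableAt ℝ (fderiv ℝ f) ((0 : ℝ) • z) := by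
      rw [zero_smul]
      exact (hf.fderiv_right (m := 1) (by norm_num)).differentiableAt (by norm_num)
    have h2 := HasFDerivAt.comp_hasDerivAt (f := fun t : ℝ => t • z) 0 h1.hasFDerivAt (hline 0)
    have h3 := h2.clm_apply (hasDerivAt_const (0 : ℝ) z)
    simpa [hessian_apply] using h3
  refine HasDerivAt.lhopital_zero_nhdsNE (f' := fun t => fderiv ℝ f (t • z) z)
    (g' := fun t => 2 * t) (hev.filter_mono nhdsWithin_le_nhds) ?_ ?_ ?_ ?_ ?_
  · exact Eventually.of_forall fun t => by simpa using hasDerivAt_pow 2 t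
  · filter_upwards [self_mem_nhdsWithin] with t ht
    exact mul_ne_zero two_ne_zero ht
  · have := hev.self_of_nhds.continuousAt.tendsto
    simpa using this.mono_left nhdsWithin_le_nhds
  · have : Tendsto (fun t : ℝ => t ^ 2) (𝓝 0) (𝓝 (0 ^ 2)) := (continuous_pow 2).tendsto 0
    simpa using this.mono_left nhdsWithin_le_nhds
  · have h3 := hasDerivAt_iff_tendsto_slope.mp hsecond
    refine (h3.div_const 2).congr fun t => ?_
    simp only [slope_def_field, zero_smul, h0, _root_.zero_apply, sub_zero]
    rw [div_div, mul_comm]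

/-- By the chain rule the derivative at `0` equals its own negative. -/
theorem fderiv_eq_zero_of_even {f : E → ℝ} (h : ∀ x, f (-x) = f x) : fderiv ℝ f 0 = 0 := by
  have h1 : fderiv ℝ (fun x => f (-x)) 0 = -fderiv ℝ f 0 := by
    simpa using fderiv_comp_smul (f := f) (x := (0 : E)) (-1 : ℝ)
  simp_rw [h] at h1
  ext v
  have h2 := DFunLike.congr_fun h1 v
  simp only [_root_.neg_apply] at h2
  simpa using self_eq_neg.mp h2

/-- The Hessian vanishes in the directions of translations that preserve the function. -/
theorem hessian_eq_zero_of_invariant {f : E → ℝ} (v : E) (h : ∀ x (t : ℝ), f (x + t • v) = f x)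
    (hd : DifferentiableAt ℝ (fderiv ℝ f) 0) (w : E) : hessian f 0 v w = 0 := by
  -- Translation invariance makes the whole derivative constant along the line `ℝ v`.
  have h1 : ∀ t : ℝ, fderiv ℝ f (t • v) = fderiv ℝ f 0 := fun t => by
    have := fderiv_comp_add_right (𝕜 := ℝ) (f := f) (x := (0 : E)) (t • v)
    simp_rw [h] at this
    simpa using this.symm
  have hline : HasDerivAt (fun t : ℝ => t • v) v 0 := by
    simpa using (hasDerivAt_id (0 : ℝ)).smul_const v
  have hd' : HasFDerivAt (fderiv ℝ f) (fderiv ℝ (fderiv ℝ f) 0) ((0 : ℝ) • v) := by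
    rw [zero_smul]; exact hd.hasFDerivAt
  have h2 := hd'.comp_hasDerivAt 0 hline
  have h3 : HasDerivAt (fderiv ℝ f ∘ fun t : ℝ => t • v) 0 0 := by
    have : (fderiv ℝ f ∘ fun t : ℝ => t • v) = fun _ => fderiv ℝ f 0 := funext h1
    rw [this]
    exact hasDerivAt_const _ _
  rw [hessian_apply, h2.unique h3, _root_.zero_apply]

theorem hessian_symm {f : E → ℝ} {x : E} (hf : ContDiffAt ℝ 2 f x) (v w : E) :
    hessian f x v w = hessian f x w v :=
  hf.isSymmSndFDerivAt (by simp) v w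

end Calculus

/-! ### Gauge invariance, evenness and smoothness of `Λ`. -/

namespace EdgeOrientation

variable {V : Type*} [DecidableEq V] {G : SimpleGraph V} (D : EdgeOrientation G)

theorem antisym_neg (α : D.EdgeSpace) (r s : V) : D.antisym (-α) r s = -D.antisym α r s := by
  unfold antisym
  split_ifs <;> simp

theorem antisym_smul (c : ℝ) (α : D.EdgeSpace) (r s : V) :
    D.antisym (c • α) r s = c * D.antisym α r s := by
  unfold antisym
  split_ifs <;> simp

theorem antisym_zero (r s : V) : D.antisym 0 r s = 0 := by
  unfold antisym
  split_ifs <;> simp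

theorem contDiff_antisym {n : WithTop ℕ∞} (r s : V) : ContDiff ℝ n fun α => D.antisym α r s := by
  unfold antisym
  split_ifs <;> fun_prop

/-- The restriction on `r, s` matters: off the edges the left side is zero while `θ s - θ r` need
not be. Those entries of `H` vanish, so nothing is lost. -/
theorem antisym_add_coboundary (α : D.EdgeSpace) (θ : V → ℝ) {r s : V} (h : r = s ∨ G.Adj r s) :
    D.antisym (α + D.coboundary θ) r s = D.antisym α r s + (θ s - θ r) := by
  rcases h with rfl | h
  · have : (r, r) ∉ D.edges := fun h => D.asymm r r h h
    simp [antisym, this]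
  · rw [D.adj_iff] at h
    unfold antisym
    by_cases h1 : (r, s) ∈ D.edges
    · simp [h1, coboundary]
    · simp only [h1, h.resolve_left h1, dite_true, dite_false, Pi.add_apply, coboundary,
        LinearMap.coe_mk, AddHom.coe_mk]
      ring

theorem phaseMatrix_zero (H : Matrix V V ℝ) : D.phaseMatrix H 0 = H.map Complex.ofRealHom := by
  ext r s
  simp [phaseMatrix, antisym_zero]

theorem phaseMatrix_neg {H : Matrix V V ℝ} (hH : H.IsSymm) (α : D.EdgeSpace) :
    D.phaseMatrix H (-α) = (D.phaseMatrix H α)ᵀ := by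
  ext r s
  simp [phaseMatrix, antisym_neg, D.antisym_swap α r s, hH.apply r s]

theorem contDiff_phaseMatrix_apply {n : WithTop ℕ∞} (H : Matrix V V ℝ) (r s : V) :
    ContDiff ℝ n fun α => D.phaseMatrix H α r s := by
  have h := D.contDiff_antisym (n := n) r s
  have h2 : ContDiff ℝ n fun α => (D.antisym α r s : ℂ) := Complex.ofRealCLM.contDiff.comp h
  exact (contDiff_const.mul h2).cexp.mul contDiff_const

variable [Fintype V]

/-- Gauge transformations of the phase perturbation are unitary conjugations. -/
theorem charpoly_phaseMatrix_add_coboundary {H : Matrix V V ℝ} (hsupp : StrictlySupported G H)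
    (α : D.EdgeSpace) (θ : V → ℝ) :
    (D.phaseMatrix H (α + D.coboundary θ)).charpoly = (D.phaseMatrix H α).charpoly := by
  set U : Matrix V V ℂ := Matrix.diagonal fun r => Complex.exp (Complex.I * θ r)
  set U' : Matrix V V ℂ := Matrix.diagonal fun r => Complex.exp (-(Complex.I * θ r))
  have hU : U * U' = 1 := by
    simp [U, U', Matrix.diagonal_mul_diagonal, ← Complex.exp_add]
  have h : D.phaseMatrix H (α + D.coboundary θ) = U' * (D.phaseMatrix H α * U) := by
    ext r s
    simp only [U, U', Matrix.diagonal_mul, Matrix.mul_diagonal, phaseMatrix, Matrix.of_apply]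
    by_cases hrs : r = s ∨ G.Adj r s
    · rw [D.antisym_add_coboundary α θ hrs, mul_right_comm _ (H r s : ℂ), ← Complex.exp_add,
        ← mul_assoc, ← Complex.exp_add]
      congr 2
      push_cast
      ring
    · push Not at hrs
      have : H r s = 0 := by
        by_contra h0
        exact hrs.2 ((hsupp r s hrs.1).mp h0)
      simp [this]
  rw [h, Matrix.charpoly_mul_comm, Matrix.mul_assoc, hU, Matrix.mul_one]

variable {H : Matrix V V ℝ} (hH : H.IsSymm) (k : ℕ) (hk₁ : 1 ≤ k) (hk : k ≤ Fintype.card V)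

theorem magneticEigenvalue_add_coboundary (hsupp : StrictlySupported G H) (α : D.EdgeSpace)
    (θ : V → ℝ) : D.magneticEigenvalue hH k hk₁ hk (α + D.coboundary θ) =
      D.magneticEigenvalue hH k hk₁ hk α :=
  kthEigenvalue_congr _ _ (D.charpoly_phaseMatrix_add_coboundary hsupp α θ) k hk₁ hk

theorem magneticEigenvalue_neg (α : D.EdgeSpace) : D.magneticEigenvalue hH k hk₁ hk (-α) =
    D.magneticEigenvalue hH k hk₁ hk α :=
  kthEigenvalue_congr _ _ (by rw [D.phaseMatrix_neg hH, Matrix.charpoly_transpose]) k hk₁ hk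

theorem magneticEigenvalue_zero : D.magneticEigenvalue hH k hk₁ hk 0 =
    kthEigenvalue (Matrix.isHermitian_iff_isSymm.mpr hH) k hk₁ hk :=
  kthEigenvalue_map_ofReal _ _ (D.phaseMatrix_zero H) k hk₁ hk

omit [Fintype V] in
theorem continuous_phaseMatrix (H : Matrix V V ℝ) : Continuous (D.phaseMatrix H) :=
  continuous_matrix fun r s => (D.contDiff_phaseMatrix_apply (n := 0) H r s).continuous

theorem continuous_magneticEigenvalue : Continuous (D.magneticEigenvalue hH k hk₁ hk) :=
  continuous_kthEigenvalue _ (D.continuous_phaseMatrix H) k hk₁ hk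

theorem contDiffAt_magneticEigenvalue {lam : ℝ}
    (hlam : lam = kthEigenvalue (Matrix.isHermitian_iff_isSymm.mpr hH) k hk₁ hk)
    (hsimple : Module.finrank ℝ (Module.End.eigenspace (Matrix.toLin' H) lam) = 1) :
    ContDiffAt ℝ 2 (D.magneticEigenvalue hH k hk₁ hk) 0 := by
  have hH' : H.IsHermitian := Matrix.isHermitian_iff_isSymm.mpr hH
  -- The determinant is real on this domain; the real part only makes the equation real-valued for
  -- the implicit function theorem.
  set p : D.EdgeSpace × ℝ → ℝ := fun q =>
    (Matrix.scalar V (q.2 : ℂ) - D.phaseMatrix H q.1).det.re with hpdef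
  have hp : ContDiff ℝ 2 p := by
    have hentry : ∀ r s : V, ContDiff ℝ 2 fun q : D.EdgeSpace × ℝ =>
        (Matrix.scalar V (q.2 : ℂ) - D.phaseMatrix H q.1) r s := by
      intro r s
      simp only [Matrix.sub_apply, Matrix.scalar_apply, Matrix.diagonal_apply]
      refine ContDiff.sub ?_ ((D.contDiff_phaseMatrix_apply H r s).comp contDiff_fst)
      split_ifs
      · exact Complex.ofRealCLM.contDiff.comp contDiff_snd
      · exact contDiff_const
    refine Complex.reCLM.contDiff.comp ?_
    simp only [Matrix.det_apply]
    exact ContDiff.sum fun σ _ => (contDiff_prod fun i _ => hentry _ _).const_smul _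
  refine (D.continuous_magneticEigenvalue hH k hk₁ hk).continuousAt.contDiffAt_of_implicit
    (c := H.charpoly.derivative.eval lam) hp ?_ ?_ ?_
  · rw [D.magneticEigenvalue_zero hH k hk₁ hk, ← hlam]
    have : (fun t : ℝ => p (0, t)) = fun t => H.charpoly.eval t := by
      ext t
      simp only [hpdef]
      rw [← Matrix.eval_charpoly, phaseMatrix_zero, Matrix.charpoly_map]
      have := Polynomial.eval_map_apply (p := H.charpoly) (f := Complex.ofRealHom) t
      rw [Complex.ofRealHom_eq_coe] at this
      rw [this]
      simp
    rw [this]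
    exact H.charpoly.hasDerivAt lam
  · refine derivative_charpoly_eval_ne_zero hH' ?_ (eigenvalues_unique_of_finrank_eq_one hH' hsimple)
    rw [hlam]
    exact exists_eigenvalues_eq_kthEigenvalue hH' k hk₁ hk
  · intro α
    have hα := D.phaseMatrix_isHermitian hH α
    obtain ⟨v, hv⟩ := exists_eigenvalues_eq_kthEigenvalue hα k hk₁ hk
    simp only [hpdef]
    rw [← Matrix.eval_charpoly, hα.charpoly_eq, Polynomial.eval_prod,
      Finset.prod_eq_zero (Finset.mem_univ v)]
    · rfl
    · rw [hv]
      simp [magneticEigenvalue]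

end EdgeOrientation

/-! ### The form `Φ`, its restriction to coboundaries, and their indices. -/

namespace EdgeOrientation

open Module

variable {V : Type*} [DecidableEq V] [Fintype V] {G : SimpleGraph V} (D : EdgeOrientation G)

/-- Each edge at `r` occurs exactly once in the orientation, either outgoing or incoming. -/
theorem sum_eq_sum_edges (F : V → V → ℝ) (hF : ∀ r s, ¬G.Adj r s → F r s = 0) (r : V) :
    ∑ s, F r s = ∑ e : ↥D.edges with e.1.1 = r, F e.1.1 e.1.2 +
      ∑ e : ↥D.edges with e.1.2 = r, F e.1.2 e.1.1 := by
  have hcoe : ∀ g : V × V → ℝ,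
      ∑ e : ↥D.edges, g e.1 = ∑ a, ∑ b, if (a, b) ∈ D.edges then g (a, b) else 0 := by
    intro g
    rw [Finset.sum_coe_sort D.edges g,
      ← Fintype.sum_prod_type' (fun a b => if (a, b) ∈ D.edges then g (a, b) else 0),
      ← Finset.sum_filter, Finset.filter_univ_mem]
  have hfst : (∑ a, ∑ b, if (a, b) ∈ D.edges then if a = r then F a b else 0 else 0) =
      ∑ s, if (r, s) ∈ D.edges then F r s else 0 := by
    rw [Finset.sum_eq_single r (fun a _ ha => Finset.sum_eq_zero fun b _ => by simp [ha])
      (by simp)]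
    simp
  have hsnd : (∑ a, ∑ b, if (a, b) ∈ D.edges then if b = r then F b a else 0 else 0) =
      ∑ s, if (s, r) ∈ D.edges then F r s else 0 := by
    refine Finset.sum_congr rfl fun a _ => ?_
    rw [Finset.sum_eq_single r (fun b _ hb => by simp [hb]) (by simp)]
    simp
  rw [Finset.sum_filter, Finset.sum_filter, hcoe fun p => if p.1 = r then F p.1 p.2 else 0,
    hcoe fun p => if p.2 = r then F p.2 p.1 else 0, hfst, hsnd, ← Finset.sum_add_distrib]
  refine Finset.sum_congr rfl fun s _ => ?_
  have h1 := D.adj_iff r s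
  have h2 := D.asymm r s
  by_cases h3 : (r, s) ∈ D.edges
  · simp [h3, h2 h3]
  · by_cases h4 : (s, r) ∈ D.edges
    · simp [h3, h4]
    · simp [h3, h4, hF r s (by tauto)]

theorem sum_sum_eq_sum_edges (F : V → V → ℝ) (hF : ∀ r s, ¬G.Adj r s → F r s = 0) :
    ∑ r, ∑ s, F r s = ∑ e : ↥D.edges, (F e.1.1 e.1.2 + F e.1.2 e.1.1) := by
  simp_rw [D.sum_eq_sum_edges F hF, Finset.sum_add_distrib]
  rw [Finset.sum_fiberwise, Finset.sum_fiberwise]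

omit [Fintype V] in
theorem antisym_edge (α : D.EdgeSpace) (e : ↥D.edges) : D.antisym α e.1.1 e.1.2 = α e := by
  simp [antisym]

omit [Fintype V] in
theorem antisym_edge_swap (α : D.EdgeSpace) (e : ↥D.edges) :
    D.antisym α e.1.2 e.1.1 = -α e := by
  rw [D.antisym_swap, antisym_edge]

/-- The cycle space is the annihilator of the image of the coboundary operator. -/
theorem mem_cycleSpace_iff (f : D.EdgeSpace) :
    f ∈ D.cycleSpace ↔ ∀ θ, ∑ e, f e * D.coboundary θ e = 0 := by
  have h : ∀ θ : V → ℝ, ∑ e, f e * D.coboundary θ e =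
      ∑ r, θ r * (∑ e : ↥D.edges with e.1.2 = r, f e - ∑ e : ↥D.edges with e.1.1 = r, f e) := by
    intro θ
    have h1 : ∀ g : ↥D.edges → V,
        ∑ r, θ r * ∑ e : ↥D.edges with g e = r, f e = ∑ e, θ (g e) * f e := fun g => by
      rw [← Finset.sum_fiberwise _ g]
      refine Finset.sum_congr rfl fun r _ => ?_
      rw [Finset.mul_sum]
      refine Finset.sum_congr rfl fun e he => ?_
      rw [(Finset.mem_filter.mp he).2]
    simp_rw [mul_sub, Finset.sum_sub_distrib]
    rw [h1 fun e => e.1.2, h1 fun e => e.1.1, ← Finset.sum_sub_distrib]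
    refine Finset.sum_congr rfl fun e _ => ?_
    simp only [coboundary, LinearMap.coe_mk, AddHom.coe_mk]
    ring
  constructor
  · intro hf θ
    rw [h]
    exact Finset.sum_eq_zero fun r _ => by rw [hf r, sub_self, mul_zero]
  · intro hf r
    -- Testing against the indicator of `r` isolates the balance condition at `r`.
    have := hf (Pi.single r 1)
    rw [h, Finset.sum_eq_single r (fun s _ hs => by simp [Pi.single_eq_of_ne hs]) (by simp)] at this
    simpa [sub_eq_zero] using this

variable {H : Matrix V V ℝ} {ψ : V → ℝ}

omit [Fintype V] in
theorem toBilin'_weight_apply (H : Matrix V V ℝ) (ψ : V → ℝ) (α β : D.EdgeSpace) :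
    Matrix.toBilin' (D.weight H ψ) α β =
      ∑ e, -(ψ e.1.1 * H e.1.1 e.1.2 * ψ e.1.2) * α e * β e := by
  rw [Matrix.toBilin'_apply', weight]
  simp only [dotProduct, Matrix.mulVec_diagonal]
  exact Finset.sum_congr rfl fun e _ => by ring

omit [Fintype V] in
theorem toBilin'_weight_isSymm (H : Matrix V V ℝ) (ψ : V → ℝ) :
    (Matrix.toBilin' (D.weight H ψ)).IsSymm := by
  refine ⟨fun α β => ?_⟩
  simp only [toBilin'_weight_apply]
  exact Finset.sum_congr rfl fun e _ => by ring

omit [DecidableEq V] [Fintype V] in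
theorem weight_ne_zero (hsupp : StrictlySupported G H) (hne : ∀ r, ψ r ≠ 0) (e : ↥D.edges) :
    -(ψ e.1.1 * H e.1.1 e.1.2 * ψ e.1.2) ≠ 0 := by
  have hadj : G.Adj e.1.1 e.1.2 := (D.adj_iff _ _).mpr (Or.inl e.2)
  exact neg_ne_zero.mpr
    (mul_ne_zero (mul_ne_zero (hne _) ((hsupp _ _ hadj.ne).mpr hadj)) (hne _))

/-- The gauge space is the orthogonal complement of `dℝ^V` with respect to `Φ`. -/
theorem gaugeSpace_eq_orthogonal (hsupp : StrictlySupported G H) (hne : ∀ r, ψ r ≠ 0) :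
    D.gaugeSpace H ψ =
      (Matrix.toBilin' (D.weight H ψ)).orthogonal (LinearMap.range D.coboundary) := by
  set w : ↥D.edges → ℝ := fun e => -(ψ e.1.1 * H e.1.1 e.1.2 * ψ e.1.2)
  have hw : ∀ e, w e ≠ 0 := D.weight_ne_zero hsupp hne
  have hinv : (D.weight H ψ)⁻¹ = Matrix.diagonal fun e => (w e)⁻¹ := by
    refine Matrix.inv_eq_right_inv ?_
    rw [weight, Matrix.diagonal_mul_diagonal, ← Matrix.diagonal_one]
    congr 1
    ext e
    exact mul_inv_cancel₀ (hw e)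
  have hmem : ∀ z, z ∈ D.gaugeSpace H ψ ↔ (fun e => w e * z e) ∈ D.cycleSpace := by
    intro z
    rw [gaugeSpace, Submodule.mem_map, hinv]
    simp only [Matrix.toLin'_apply]
    constructor
    · rintro ⟨f, hf, rfl⟩
      convert! hf using 1
      ext e
      simp only [Matrix.mulVec_diagonal]
      rw [mul_inv_cancel_left₀ (hw e)]
    · refine fun hz => ⟨_, hz, ?_⟩
      ext e
      simp only [Matrix.mulVec_diagonal]
      rw [inv_mul_cancel_left₀ (hw e)]
  ext z
  rw [hmem, mem_cycleSpace_iff, LinearMap.BilinForm.mem_orthogonal_iff]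
  simp only [LinearMap.mem_range, forall_exists_index, forall_apply_eq_imp_iff,
    toBilin'_weight_apply]
  refine forall_congr' fun θ => ?_
  rw [Finset.sum_congr rfl fun e _ => mul_right_comm (w e) (z e) _]

/-- The form `Φ` on coboundaries is `H - λ` conjugated by multiplication by `ψ`. -/
theorem toBilin'_weight_coboundary (hH : H.IsSymm) (hsupp : StrictlySupported G H) {lam : ℝ}
    (hψ : H *ᵥ ψ = lam • ψ) (θ η : V → ℝ) :
    Matrix.toBilin' (D.weight H ψ) (D.coboundary θ) (D.coboundary η) =
      ∑ r, ψ r * η r * ((H *ᵥ (ψ * θ)) r - lam * (ψ r * θ r)) := by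
  have h1 : ∀ r, ψ r * η r * ((H *ᵥ (ψ * θ)) r - lam * (ψ r * θ r)) =
      ∑ s, ψ r * H r s * ψ s * η r * (θ s - θ r) := by
    intro r
    -- Eliminating `lam` by the eigenvalue equation leaves differences `θ s - θ r`, so the diagonal
    -- of `H` drops out.
    have h2 : lam * ψ r = ∑ s, H r s * ψ s := by
      have := congrFun hψ r
      simp only [Pi.smul_apply, smul_eq_mul] at this
      exact this.symm
    rw [← mul_assoc lam, h2, Matrix.mulVec, dotProduct, Finset.sum_mul, ← Finset.sum_sub_distrib,
      Finset.mul_sum]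
    refine Finset.sum_congr rfl fun s _ => ?_
    simp only [Pi.mul_apply]
    ring
  simp_rw [h1]
  rw [D.sum_sum_eq_sum_edges (fun r s => ψ r * H r s * ψ s * η r * (θ s - θ r)),
    toBilin'_weight_apply]
  · refine Finset.sum_congr rfl fun e _ => ?_
    rw [hH.apply]
    simp only [coboundary, LinearMap.coe_mk, AddHom.coe_mk]
    ring
  · intro r s hrs
    rcases eq_or_ne r s with rfl | hne
    · simp
    · have : H r s = 0 := by
        by_contra h0
        exact hrs ((hsupp r s hne).mp h0)
      simp [this]

/-- It suffices that `Φ` is nondegenerate on `dℝ^V`. If `dθ` is `Φ`-orthogonal to `dℝ^V`, then `(H -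
λ)(ψθ) = 0`; by simplicity `ψθ` is a multiple of `ψ`, so `θ` is constant and `dθ = 0`. -/
theorem isCompl_gaugeSpace (hH : H.IsSymm) (hsupp : StrictlySupported G H) {lam : ℝ}
    (hsimple : finrank ℝ (End.eigenspace (Matrix.toLin' H) lam) = 1)
    (hψ : H *ᵥ ψ = lam • ψ) (hne : ∀ r, ψ r ≠ 0) :
    IsCompl (D.gaugeSpace H ψ) (LinearMap.range D.coboundary) := by
  rw [D.gaugeSpace_eq_orthogonal hsupp hne]
  refine IsCompl.symm ?_
  have hsymm := D.toBilin'_weight_isSymm H ψ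
  rw [LinearMap.BilinForm.isCompl_orthogonal_iff_disjoint hsymm.isRefl, Submodule.disjoint_def]
  rintro _ ⟨θ, rfl⟩ hθ
  rw [LinearMap.BilinForm.mem_orthogonal_iff] at hθ
  have hker : H *ᵥ (ψ * θ) = lam • (ψ * θ) := by
    ext r
    have h1 := hθ _ ⟨Pi.single r 1, rfl⟩
    rw [hsymm.eq,
      D.toBilin'_weight_coboundary hH hsupp hψ,
      Finset.sum_eq_single r (fun s _ hs => by simp [Pi.single_eq_of_ne hs]) (by simp)] at h1
    simp only [Pi.single_eq_same, mul_one, mul_eq_zero, hne r, false_or] at h1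
    simpa [sub_eq_zero] using h1
  by_cases hV : IsEmpty V
  · ext e
    exact hV.elim e.1.1
  rw [not_isEmpty_iff] at hV
  obtain ⟨r₀⟩ := hV
  have hmem : ∀ v : V → ℝ, H *ᵥ v = lam • v → v ∈ End.eigenspace (Matrix.toLin' H) lam :=
    fun v hv => by rw [End.mem_eigenspace_iff, Matrix.toLin'_apply, hv]
  have hψ0 : (⟨ψ, hmem ψ hψ⟩ : End.eigenspace (Matrix.toLin' H) lam) ≠ 0 := fun h =>
    hne r₀ (congrFun (congrArg Subtype.val h) r₀)
  obtain ⟨c, hc⟩ := (finrank_eq_one_iff_of_nonzero' _ hψ0).mp hsimple ⟨_, hmem _ hker⟩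
  have hconst : ∀ r, θ r = c := fun r => by
    have := congrFun (congrArg Subtype.val hc) r
    simp only [Submodule.coe_smul, Pi.smul_apply, smul_eq_mul, Pi.mul_apply] at this
    refine mul_left_cancel₀ (hne r) ?_
    rw [← this, mul_comm]
  ext e
  simp [coboundary, hconst]

open QuadraticMap QuadraticForm

omit [Fintype V] in
theorem sigNeg_weight (H : Matrix V V ℝ) (ψ : V → ℝ) :
    sigNeg (Matrix.toBilin' (D.weight H ψ)).toQuadraticMap = D.nodalCount H ψ := by
  have : (Matrix.toBilin' (D.weight H ψ)).toQuadraticMap =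
      weightedSumSquares ℝ fun e : ↥D.edges => -(ψ e.1.1 * H e.1.1 e.1.2 * ψ e.1.2) := by
    ext α
    simp [weightedSumSquares_apply, toBilin'_weight_apply, mul_assoc]
  rw [this, sigNeg_weightedSumSquares, nodalCount, ← Nat.card_eq_fintype_card, ← Nat.card_coe_set_eq]
  simp only [Left.neg_neg_iff]
  rfl

theorem dotProduct_mulVec_eq_sum_eigenvalues {A : Matrix V V ℝ} (hA : A.IsHermitian) (x : V → ℝ) :
    x ⬝ᵥ A *ᵥ x =
      ∑ j, hA.eigenvalues j * (hA.eigenvectorBasis.repr (WithLp.toLp 2 x) j) ^ 2 := by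
  have h1 : x ⬝ᵥ A *ᵥ x = inner ℝ (WithLp.toLp 2 x) (WithLp.toLp 2 (A *ᵥ x)) := by
    rw [EuclideanSpace.inner_toLp_toLp]
    simp [dotProduct_comm]
  rw [h1, ← hA.eigenvectorBasis.sum_inner_mul_inner]
  refine Finset.sum_congr rfl fun j _ => ?_
  have h2 : inner ℝ (hA.eigenvectorBasis j) (WithLp.toLp 2 (A *ᵥ x)) =
      hA.eigenvalues j * inner ℝ (hA.eigenvectorBasis j) (WithLp.toLp 2 x) := by
    rw [EuclideanSpace.inner_eq_star_dotProduct, EuclideanSpace.inner_eq_star_dotProduct]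
    simp only [star_trivial]
    rw [dotProduct_comm, Matrix.dotProduct_mulVec, ← Matrix.mulVec_transpose,
      (Matrix.isHermitian_iff_isSymm.mp hA).eq, hA.mulVec_eigenvectorBasis, smul_dotProduct,
      dotProduct_comm, smul_eq_mul]
  rw [h2, OrthonormalBasis.repr_apply_apply, real_inner_comm]
  ring

/-- In the coordinates `y` of `ψθ` in an orthonormal eigenbasis of `H`, `Φ(dθ, dθ) = ∑ (λ_j - λ)
y_j²`. The map `θ ↦ y` is onto because `ψ` has no zeros. -/
theorem sigNeg_weight_coboundary (hH : H.IsSymm) (hsupp : StrictlySupported G H) (k : ℕ)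
    (hk₁ : 1 ≤ k) (hk : k ≤ Fintype.card V) {lam : ℝ}
    (hlam : lam = kthEigenvalue (Matrix.isHermitian_iff_isSymm.mpr hH) k hk₁ hk)
    (hsimple : finrank ℝ (End.eigenspace (Matrix.toLin' H) lam) = 1)
    (hψ : H *ᵥ ψ = lam • ψ) (hne : ∀ r, ψ r ≠ 0) :
    sigNeg ((Matrix.toBilin' (D.weight H ψ)).toQuadraticMap.restrict
      (LinearMap.range D.coboundary)) = k - 1 := by
  have hH' : H.IsHermitian := Matrix.isHermitian_iff_isSymm.mpr hH
  rw [← ncard_eigenvalues_lt hH' k hk₁ hk hlam (eigenvalues_unique_of_finrank_eq_one hH' hsimple)]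
  have hset : {i | hH'.eigenvalues i < lam} = {i | hH'.eigenvalues i - lam < 0} := by
    simp only [sub_neg]
  rw [hset, ← sigNeg_weightedSumSquares]
  set B := (Matrix.toBilin' (D.weight H ψ)).toQuadraticMap with hB
  set b := hH'.eigenvectorBasis
  let g : (V → ℝ) →ₗ[ℝ] (V → ℝ) :=
    (WithLp.linearEquiv 2 ℝ (V → ℝ)).toLinearMap ∘ₗ b.repr.toLinearEquiv.toLinearMap ∘ₗ
      (WithLp.linearEquiv 2 ℝ (V → ℝ)).symm.toLinearMap ∘ₗ LinearMap.mulLeft ℝ ψ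
  have hg : ∀ θ, g θ = b.repr (WithLp.toLp 2 (ψ * θ)) := fun θ => rfl
  have hgs : Function.Surjective g := by
    intro y
    refine ⟨ψ⁻¹ * (b.repr.symm (WithLp.toLp 2 y)).ofLp, ?_⟩
    have : ψ * (ψ⁻¹ * (b.repr.symm (WithLp.toLp 2 y)).ofLp) =
        (b.repr.symm (WithLp.toLp 2 y)).ofLp := by
      ext r
      exact mul_inv_cancel_left₀ (hne r) _
    rw [hg, this, WithLp.toLp_ofLp, LinearIsometryEquiv.apply_symm_apply]
  rw [← sigNeg_eq_of_comp_surjective (B.comp D.coboundary)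
    (B.restrict (LinearMap.range D.coboundary)) D.coboundary.rangeRestrict
    D.coboundary.surjective_rangeRestrict fun x => rfl,
    sigNeg_eq_of_comp_surjective (B.comp D.coboundary) _ g hgs]
  intro θ
  rw [QuadraticMap.comp_apply, hB, LinearMap.BilinMap.toQuadraticMap_apply,
    D.toBilin'_weight_coboundary hH hsupp hψ, weightedSumSquares_apply]
  have h1 := dotProduct_mulVec_eq_sum_eigenvalues hH' (ψ * θ)
  have h2 : (ψ * θ) ⬝ᵥ (ψ * θ) = ∑ j, (b.repr (WithLp.toLp 2 (ψ * θ)) j) ^ 2 := by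
    have := b.sum_sq_norm_inner_right (WithLp.toLp 2 (ψ * θ))
    rw [EuclideanSpace.real_norm_sq_eq] at this
    simp only [b.repr_apply_apply]
    simp only [Real.norm_eq_abs, sq_abs] at this
    rw [this, dotProduct]
    exact Finset.sum_congr rfl fun r _ => (pow_two _).symm
  calc _ = ∑ j, (hH'.eigenvalues j * b.repr (WithLp.toLp 2 (ψ * θ)) j ^ 2 -
        lam * b.repr (WithLp.toLp 2 (ψ * θ)) j ^ 2) := by
        refine Finset.sum_congr rfl fun j _ => ?_
        rw [hg, smul_eq_mul]
        ring
    _ = _ := by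
        rw [Finset.sum_sub_distrib, ← h1, ← Finset.mul_sum, ← h2, dotProduct, dotProduct,
          Finset.mul_sum, ← Finset.sum_sub_distrib]
        refine Finset.sum_congr rfl fun r _ => ?_
        simp only [Pi.mul_apply]
        ring

end EdgeOrientation

/-! ### Second-order perturbation along `Φ⁻¹Z`. -/

open Filter Topology in
/-- The second order Taylor coefficient of `t ↦ exp(i a t)`. -/
theorem tendsto_exp_mul_I_sub_div_sq (a : ℝ) :
    Tendsto (fun t : ℝ => (Complex.exp (Complex.I * ((t * a : ℝ) : ℂ)) - 1 -
      Complex.I * ((t * a : ℝ) : ℂ)) / (t : ℂ) ^ 2) (𝓝[≠] 0) (𝓝 (-(a : ℂ) ^ 2 / 2)) := by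
  have hlim : Tendsto (fun t : ℝ => Complex.I * ((t * a : ℝ) : ℂ)) (𝓝 0) (𝓝 0) := by
    have : Continuous fun t : ℝ => Complex.I * ((t * a : ℝ) : ℂ) := by fun_prop
    simpa using this.tendsto 0
  have h1 := (Complex.exp_sub_sum_range_succ_isLittleO_pow 2).comp_tendsto hlim
  have h2 : ((fun x : ℂ => x ^ 2) ∘ fun t : ℝ => Complex.I * ((t * a : ℝ) : ℂ)) =O[𝓝 0]
      fun t : ℝ => (t : ℂ) ^ 2 := by
    refine Asymptotics.IsBigO.of_bound (a ^ 2) (Eventually.of_forall fun t => ?_)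
    simp [mul_pow, mul_comm]
  have h3 := (h1.trans_isBigO h2).tendsto_div_nhds_zero.mono_left (nhdsWithin_le_nhds (s := {0}ᶜ))
  have h4 := h3.add_const (-(a : ℂ) ^ 2 / 2)
  rw [zero_add] at h4
  refine h4.congr' ?_
  filter_upwards [self_mem_nhdsWithin] with t ht
  have ht' : (t : ℂ) ≠ 0 := Complex.ofReal_ne_zero.mpr ht
  simp only [Function.comp_apply, Finset.sum_range_succ, Finset.sum_range_zero, pow_zero, pow_one,
    Nat.factorial]
  push_cast
  field_simp
  ring_nf
  simp only [Complex.I_sq]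
  ring

namespace EdgeOrientation

open Module Filter Topology

variable {V : Type*} [DecidableEq V] [Fintype V] {G : SimpleGraph V} (D : EdgeOrientation G)
  {H : Matrix V V ℝ} {ψ : V → ℝ}

theorem toBilin'_weight_coboundary_left (hH : H.IsSymm)
    (θ : V → ℝ) (z : D.EdgeSpace) :
    Matrix.toBilin' (D.weight H ψ) (D.coboundary θ) z =
      ∑ r, θ r * ψ r * ∑ s, D.antisym z r s * (H r s * ψ s) := by
  have h := D.sum_sum_eq_sum_edges
    (fun r s => θ r * ψ r * (D.antisym z r s * (H r s * ψ s))) ?_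
  · simp_rw [Finset.mul_sum]
    rw [h, toBilin'_weight_apply]
    refine Finset.sum_congr rfl fun e _ => ?_
    rw [antisym_edge, antisym_edge_swap, hH.apply]
    simp only [coboundary, LinearMap.coe_mk, AddHom.coe_mk]
    ring
  · intro r s hrs
    have : D.antisym z r s = 0 := by
      rw [D.adj_iff] at hrs
      push Not at hrs
      simp [antisym, hrs.1, hrs.2]
    simp [this]

/-- This is `Φ`-orthogonality to the coboundary of the indicator of `r`. It says that the
first-order perturbation of `H` along `z` kills `ψ`. -/
theorem sum_antisym_eq_zero_of_mem_gaugeSpace (hH : H.IsSymm) (hsupp : StrictlySupported G H)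
    (hne : ∀ r, ψ r ≠ 0) {z : D.EdgeSpace} (hz : z ∈ D.gaugeSpace H ψ) (r : V) :
    ∑ s, D.antisym z r s * (H r s * ψ s) = 0 := by
  rw [D.gaugeSpace_eq_orthogonal hsupp hne, LinearMap.BilinForm.mem_orthogonal_iff] at hz
  have h := hz _ ⟨Pi.single r 1, rfl⟩
  rw [D.toBilin'_weight_coboundary_left hH,
    Finset.sum_eq_single r (fun s _ hs => by simp [Pi.single_eq_of_ne hs]) (by simp)] at h
  simpa [hne r] using h

/-- The right side is `⟨ψ, (d²/dt²) H_{tz} ψ⟩` at `t = 0`; the `2` appears because each edge is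
counted in both directions. -/
theorem toBilin'_weight_self (hH : H.IsSymm) (z : D.EdgeSpace) :
    2 * Matrix.toBilin' (D.weight H ψ) z z =
      -∑ r, ψ r * ∑ s, D.antisym z r s ^ 2 * (H r s * ψ s) := by
  have h := D.sum_sum_eq_sum_edges
    (fun r s => ψ r * (D.antisym z r s ^ 2 * (H r s * ψ s))) ?_
  · simp_rw [Finset.mul_sum]
    rw [h, toBilin'_weight_apply, Finset.mul_sum, ← Finset.sum_neg_distrib]
    refine Finset.sum_congr rfl fun e _ => ?_
    rw [antisym_edge, antisym_edge_swap, hH.apply]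
    ring
  · intro r s hrs
    have : D.antisym z r s = 0 := by
      rw [D.adj_iff] at hrs
      push Not at hrs
      simp [antisym, hrs.1, hrs.2]
    simp [this]

/-- A complex eigenvector for a real eigenvalue whose real eigenspace is spanned by `ψ` is a
multiple of `ψ`. -/
theorem exists_eq_mul_of_eigenvector {lam : ℝ}
    (hsimple : finrank ℝ (End.eigenspace (Matrix.toLin' H) lam) = 1)
    (hψ : H *ᵥ ψ = lam • ψ) (hψ0 : ψ ≠ 0) {x : V → ℂ}
    (hx : H.map Complex.ofRealHom *ᵥ x = (lam : ℂ) • x) : ∃ c : ℂ, ∀ r, x r = c * ψ r := by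
  have hmem : ∀ v : V → ℝ, H *ᵥ v = lam • v → v ∈ End.eigenspace (Matrix.toLin' H) lam :=
    fun v hv => by rw [End.mem_eigenspace_iff, Matrix.toLin'_apply, hv]
  have hspan : ∀ v : V → ℝ, H *ᵥ v = lam • v → ∃ c : ℝ, v = c • ψ := fun v hv => by
    have h0 : (⟨ψ, hmem ψ hψ⟩ : End.eigenspace (Matrix.toLin' H) lam) ≠ 0 := fun h =>
      hψ0 (congrArg Subtype.val h)
    obtain ⟨c, hc⟩ := (finrank_eq_one_iff_of_nonzero' _ h0).mp hsimple ⟨v, hmem v hv⟩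
    exact ⟨c, (congrArg Subtype.val hc).symm⟩
  have hcoord : ∀ r, ∑ s, (H r s : ℂ) * x s = lam * x r := fun r => by
    simpa [Matrix.mulVec, dotProduct] using congrFun hx r
  obtain ⟨a, ha⟩ := hspan (fun r => (x r).re) <| by
    ext r
    simpa [Matrix.mulVec, dotProduct] using congrArg Complex.re (hcoord r)
  obtain ⟨b, hb⟩ := hspan (fun r => (x r).im) <| by
    ext r
    simpa [Matrix.mulVec, dotProduct] using congrArg Complex.im (hcoord r)
  refine ⟨⟨a, b⟩, fun r => ?_⟩
  apply Complex.ext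
  · simpa using congrFun ha r
  · simpa using congrFun hb r

variable (hH : H.IsSymm) (k : ℕ) (hk₁ : 1 ≤ k) (hk : k ≤ Fintype.card V)

theorem exists_unit_eigenvector (α : D.EdgeSpace) : ∃ x : EuclideanSpace ℂ V, ‖x‖ = 1 ∧
    D.phaseMatrix H α *ᵥ x.ofLp = (D.magneticEigenvalue hH k hk₁ hk α : ℂ) • x.ofLp := by
  have hα := D.phaseMatrix_isHermitian hH α
  obtain ⟨v, hv⟩ := exists_eigenvalues_eq_kthEigenvalue hα k hk₁ hk
  refine ⟨hα.eigenvectorBasis v, hα.eigenvectorBasis.orthonormal.1 v, ?_⟩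
  rw [hα.mulVec_eigenvectorBasis, hv, magneticEigenvalue]
  ext r
  simp

/-- The residual of the unperturbed eigenvector, to second order. -/
theorem tendsto_residual_div_sq {lam : ℝ} (hψ : H *ᵥ ψ = lam • ψ) {z : D.EdgeSpace} (r : V)
    (hz : ∑ s, D.antisym z r s * (H r s * ψ s) = 0) {f : ℝ → ℝ} {c : ℝ}
    (hf : Tendsto (fun t : ℝ => (f t - lam) / t ^ 2) (𝓝[≠] 0) (𝓝 c)) :
    Tendsto (fun t : ℝ => ((D.phaseMatrix H (t • z) *ᵥ fun s => (ψ s : ℂ)) r - f t * ψ r) /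
      (t : ℂ) ^ 2) (𝓝[≠] 0)
      (𝓝 ((-(∑ s, D.antisym z r s ^ 2 * (H r s * ψ s)) / 2 - c * ψ r : ℝ) : ℂ)) := by
  have h1 : Tendsto (fun t : ℝ => (((f t - lam) / t ^ 2 * ψ r : ℝ) : ℂ)) (𝓝[≠] 0)
      (𝓝 ((c * ψ r : ℝ) : ℂ)) :=
    (Complex.continuous_ofReal.tendsto _).comp (hf.mul_const (ψ r))
  have h2 : Tendsto (fun t : ℝ => ∑ s, (Complex.exp (Complex.I * ((t * D.antisym z r s : ℝ) : ℂ)) -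
      1 - Complex.I * ((t * D.antisym z r s : ℝ) : ℂ)) / (t : ℂ) ^ 2 * ((H r s * ψ s : ℝ) : ℂ))
      (𝓝[≠] 0) (𝓝 (∑ s, -(D.antisym z r s : ℂ) ^ 2 / 2 * ((H r s * ψ s : ℝ) : ℂ))) :=
    tendsto_finsetSum _ fun s _ => (tendsto_exp_mul_I_sub_div_sq _).mul_const _
  have h3 := h2.sub h1
  have hlim : ∑ s, -(D.antisym z r s : ℂ) ^ 2 / 2 * ((H r s * ψ s : ℝ) : ℂ) -
      ((c * ψ r : ℝ) : ℂ) =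
      ((-(∑ s, D.antisym z r s ^ 2 * (H r s * ψ s)) / 2 - c * ψ r : ℝ) : ℂ) := by
    push_cast
    rw [← Finset.sum_neg_distrib, Finset.sum_div]
    congr 1
    exact Finset.sum_congr rfl fun s _ => by ring
  rw [hlim] at h3
  refine h3.congr' ?_
  filter_upwards [self_mem_nhdsWithin] with t ht
  have ht' : (t : ℂ) ≠ 0 := Complex.ofReal_ne_zero.mpr ht
  have hz' : ∑ s, (D.antisym z r s : ℂ) * ((H r s : ℂ) * (ψ s : ℂ)) = 0 := by
    exact_mod_cast hz
  have hψ' : ∑ s, (H r s : ℂ) * (ψ s : ℂ) = (lam : ℂ) * ψ r := by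
    have := congrFun hψ r
    simp only [Matrix.mulVec, dotProduct, Pi.smul_apply, smul_eq_mul] at this
    exact_mod_cast this
  have h4 : ∀ s, (Complex.exp (Complex.I * ((t * D.antisym z r s : ℝ) : ℂ)) - 1 -
      Complex.I * ((t * D.antisym z r s : ℝ) : ℂ)) / (t : ℂ) ^ 2 * ((H r s * ψ s : ℝ) : ℂ) =
      (Complex.exp (Complex.I * ((t * D.antisym z r s : ℝ) : ℂ)) * (H r s : ℂ) * (ψ s : ℂ) -
        (H r s : ℂ) * (ψ s : ℂ) -
        Complex.I * t * ((D.antisym z r s : ℂ) * ((H r s : ℂ) * (ψ s : ℂ)))) / (t : ℂ) ^ 2 := by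
    intro s
    push_cast
    ring
  simp_rw [h4]
  rw [← Finset.sum_div, Finset.sum_sub_distrib, Finset.sum_sub_distrib, ← Finset.mul_sum, hz', hψ']
  simp only [Matrix.mulVec, dotProduct, phaseMatrix, Matrix.of_apply, antisym_smul]
  push_cast
  ring

/-- No differentiable choice of eigenvectors is needed: a limit point of unit eigenvectors of
`H_{tz}` exists by compactness, and simplicity forces it to be a nonzero multiple of `ψ`. -/
theorem hessian_magneticEigenvalue_self_of_mem_gaugeSpace (hsupp : StrictlySupported G H)
    {lam : ℝ} (hlam : lam = kthEigenvalue (Matrix.isHermitian_iff_isSymm.mpr hH) k hk₁ hk)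
    (hsimple : finrank ℝ (End.eigenspace (Matrix.toLin' H) lam) = 1)
    (hψ : H *ᵥ ψ = lam • ψ) (hnorm : ∑ r, ψ r ^ 2 = 1) (hne : ∀ r, ψ r ≠ 0)
    {z : D.EdgeSpace} (hz : z ∈ D.gaugeSpace H ψ) :
    hessian (D.magneticEigenvalue hH k hk₁ hk) 0 z z =
      2 * Matrix.toBilin' (D.weight H ψ) z z := by
  set L := D.magneticEigenvalue hH k hk₁ hk
  have hL0 : L 0 = lam := (D.magneticEigenvalue_zero hH k hk₁ hk).trans hlam.symm
  have htaylor := (D.contDiffAt_magneticEigenvalue hH k hk₁ hk hlam hsimple).tendsto_div_sq_hessian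
    (fderiv_eq_zero_of_even (D.magneticEigenvalue_neg hH k hk₁ hk)) z
  rw [show D.magneticEigenvalue hH k hk₁ hk 0 = lam from hL0] at htaylor
  set h := hessian L 0 z z
  have hres := fun r => D.tendsto_residual_div_sq hψ r
    (D.sum_antisym_eq_zero_of_mem_gaugeSpace hH hsupp hne hz r) htaylor
  set v : V → ℝ := fun r => -(∑ s, D.antisym z r s ^ 2 * (H r s * ψ s)) / 2 - h / 2 * ψ r with hv
  choose x hx1 hx using fun t : ℝ => D.exists_unit_eigenvector hH k hk₁ hk (t • z)
  -- `H_{tz} - Λ(tz)` is Hermitian and kills `x t`, so its value at `ψ` is orthogonal to `x t`.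
  have horth : ∀ t : ℝ, ∑ r, star (x t r) *
      (((D.phaseMatrix H (t • z) *ᵥ fun s => (ψ s : ℂ)) r - L (t • z) * ψ r) / (t : ℂ) ^ 2) = 0 := by
    intro t
    have h1 : star (x t).ofLp ⬝ᵥ (D.phaseMatrix H (t • z) *ᵥ fun s => (ψ s : ℂ)) =
        L (t • z) * (star (x t).ofLp ⬝ᵥ fun s => (ψ s : ℂ)) := by
      have h2 := congrArg star (hx t)
      rw [Matrix.star_mulVec, (D.phaseMatrix_isHermitian hH (t • z)).eq] at h2
      rw [Matrix.dotProduct_mulVec, h2, star_smul, smul_dotProduct]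
      simp [L]
    simp_rw [← mul_div_assoc]
    rw [← Finset.sum_div]
    simp_rw [mul_sub]
    rw [Finset.sum_sub_distrib]
    simp only [dotProduct, Pi.star_apply] at h1
    rw [h1, Finset.mul_sum, ← Finset.sum_sub_distrib]
    rw [Finset.sum_eq_zero fun r _ => by ring, zero_div]
  -- a limit point of the unit eigenvectors along `t → 0`
  obtain ⟨y, hy, φ, hφ, hlim⟩ := (isCompact_sphere (0 : EuclideanSpace ℂ V) 1).tendsto_subseq
    (x := fun n : ℕ => x (1 / ((n : ℝ) + 1))) fun n => by simp [hx1]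
  set u : ℕ → ℝ := fun n => 1 / ((φ n : ℝ) + 1) with hu
  have hu0 : Tendsto u atTop (𝓝 0) := tendsto_one_div_add_atTop_nhds_zero_nat.comp hφ.tendsto_atTop
  have hune : Tendsto u atTop (𝓝[≠] 0) := by
    refine tendsto_nhdsWithin_iff.mpr ⟨hu0, Eventually.of_forall fun n => ?_⟩
    have : (0 : ℝ) < u n := by positivity
    exact this.ne'
  have hcoord : ∀ r, Tendsto (fun n => x (u n) r) atTop (𝓝 (y r)) := fun r =>
    ((EuclideanSpace.proj (𝕜 := ℂ) r).continuous.tendsto y).comp hlim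
  have huz : Tendsto (fun n => u n • z) atTop (𝓝 0) := by
    simpa using hu0.smul_const z
  have hyeig : H.map Complex.ofRealHom *ᵥ y.ofLp = (lam : ℂ) • y.ofLp := by
    ext r
    have h1 : Tendsto (fun n => ∑ s, D.phaseMatrix H (u n • z) r s * x (u n) s) atTop
        (𝓝 (∑ s, D.phaseMatrix H 0 r s * y s)) :=
      tendsto_finsetSum _ fun s _ =>
        (((D.contDiff_phaseMatrix_apply (n := 0) H r s).continuous.tendsto 0).comp huz).mul
          (hcoord s)
    have h2 : Tendsto (fun n => (L (u n • z) : ℂ) * x (u n) r) atTop (𝓝 (lam * y r)) := by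
      refine Tendsto.mul ?_ (hcoord r)
      rw [← hL0]
      exact (Complex.continuous_ofReal.tendsto _).comp
        (((D.continuous_magneticEigenvalue hH k hk₁ hk).tendsto 0).comp huz)
    rw [← D.phaseMatrix_zero H]
    refine tendsto_nhds_unique h1 (h2.congr fun n => ?_)
    exact (congrFun (hx (u n)) r).symm
  have hψ0 : ψ ≠ 0 := by
    rintro rfl
    simp at hnorm
  obtain ⟨c, hc⟩ := exists_eq_mul_of_eigenvector hsimple hψ hψ0 hyeig
  have hc0 : c ≠ 0 := by
    rintro rfl
    have : y = 0 := by
      ext r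
      simpa using hc r
    simp [this] at hy
  have hzero : ∑ r, star (y r) * (v r : ℂ) = 0 := by
    have h1 : Tendsto (fun n => ∑ r, star (x (u n) r) *
        (((D.phaseMatrix H (u n • z) *ᵥ fun s => (ψ s : ℂ)) r - L (u n • z) * ψ r) /
          (u n : ℂ) ^ 2)) atTop (𝓝 (∑ r, star (y r) * (v r : ℂ))) :=
      tendsto_finsetSum _ fun r _ => (hcoord r).star.mul ((hres r).comp hune)
    simp_rw [horth] at h1
    exact tendsto_nhds_unique h1 tendsto_const_nhds
  have hreal : ∑ r, ψ r * v r = 0 := by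
    have h1 : star c * ((∑ r, ψ r * v r : ℝ) : ℂ) = 0 := by
      rw [← hzero]
      push_cast
      rw [Finset.mul_sum]
      refine Finset.sum_congr rfl fun r _ => ?_
      rw [hc r]
      simp [mul_assoc]
    exact Complex.ofReal_eq_zero.mp ((mul_eq_zero.mp h1).resolve_left (star_ne_zero.mpr hc0))
  rw [D.toBilin'_weight_self hH]
  have h1 : ∑ r, ψ r * v r =
      -(∑ r, ψ r * ∑ s, D.antisym z r s ^ 2 * (H r s * ψ s)) / 2 - h / 2 * ∑ r, ψ r ^ 2 := by
    rw [Finset.mul_sum, ← Finset.sum_neg_distrib, Finset.sum_div, ← Finset.sum_sub_distrib]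
    refine Finset.sum_congr rfl fun r _ => ?_
    simp only [hv]
    ring
  rw [h1, hnorm] at hreal
  linarith

end EdgeOrientation

/-! ### Assembly of the Hessian and the index. -/

theorem theorem5p1 {V : Type*} [Fintype V] [DecidableEq V] (G : SimpleGraph V)
    (hG : G.Connected) (D : EdgeOrientation G)
    (H : Matrix V V ℝ) (hH : H.IsSymm) (hsupp : StrictlySupported G H)
    (k : ℕ) (hk₁ : 1 ≤ k) (hk : k ≤ Fintype.card V)
    (lam : ℝ)
    (hlam : lam = kthEigenvalue (Matrix.isHermitian_iff_isSymm.mpr hH) k hk₁ hk)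
    (hsimple : Module.finrank ℝ (Module.End.eigenspace (Matrix.toLin' H) lam) = 1)
    (ψ : V → ℝ) (hψ : H *ᵥ ψ = lam • ψ) (hnorm : ∑ r, ψ r ^ 2 = 1) (hne : ∀ r, ψ r ≠ 0) :
    ContDiffAt ℝ 2 (D.magneticEigenvalue hH k hk₁ hk) 0 ∧
    fderiv ℝ (D.magneticEigenvalue hH k hk₁ hk) 0 = 0 ∧
    (∃ h : IsCompl (D.gaugeSpace H ψ) (LinearMap.range D.coboundary),
      hessian (D.magneticEigenvalue hH k hk₁ hk) 0 =
        directSumForm h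
          ((2 : ℝ) • (Matrix.toBilin' (D.weight H ψ)).restrict (D.gaugeSpace H ψ)) 0) ∧
    (morseIndex (hessian (D.magneticEigenvalue hH k hk₁ hk) 0) : ℤ) =
      (D.nodalCount H ψ : ℤ) - ((k : ℤ) - 1) := by
  set L := D.magneticEigenvalue hH k hk₁ hk
  set B := Matrix.toBilin' (D.weight H ψ)
  have hsmooth : ContDiffAt ℝ 2 L 0 := D.contDiffAt_magneticEigenvalue hH k hk₁ hk hlam hsimple
  have hcompl := D.isCompl_gaugeSpace hH hsupp hsimple hψ hne
  have hBsymm : B.IsSymm := D.toBilin'_weight_isSymm H ψ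
  have hgauge : ∀ u ∈ LinearMap.range D.coboundary, ∀ β, hessian L 0 u β = 0 := by
    rintro _ ⟨θ, rfl⟩ β
    refine hessian_eq_zero_of_invariant _ (fun α t => ?_) ?_ β
    · rw [← map_smul]
      exact D.magneticEigenvalue_add_coboundary hH k hk₁ hk hsupp α _
    · exact (hsmooth.fderiv_right (m := 1) (by norm_num)).differentiableAt (by norm_num)
  have hdiag : ∀ z ∈ D.gaugeSpace H ψ, hessian L 0 z z = 2 * B z z := fun z hz =>
    D.hessian_magneticEigenvalue_self_of_mem_gaugeSpace hH k hk₁ hk hsupp hlam hsimple hψ hnorm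
      hne hz
  -- Polarization: both forms are symmetric and agree on the diagonal.
  have hpolar : ∀ z ∈ D.gaugeSpace H ψ, ∀ w ∈ D.gaugeSpace H ψ,
      hessian L 0 z w = 2 * B z w := by
    intro z hz w hw
    have h1 := hdiag _ (add_mem hz hw)
    simp only [map_add, LinearMap.add_apply] at h1
    have h2 := hessian_symm hsmooth w z
    have h3 : B w z = B z w := hBsymm.eq w z
    linarith [hdiag z hz, hdiag w hw]
  have hform : hessian L 0 = directSumForm hcompl ((2 : ℝ) • B.restrict (D.gaugeSpace H ψ)) 0 := by
    refine LinearMap.ext₂ fun α β => ?_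
    have htop := fun α => hcompl.sup_eq_top.ge (Submodule.mem_top (x := α))
    obtain ⟨z, hz, u, hu, rfl⟩ := Submodule.mem_sup.mp (htop α)
    obtain ⟨w, hw, y, hy, rfl⟩ := Submodule.mem_sup.mp (htop β)
    have hproj : ∀ a ∈ D.gaugeSpace H ψ, ∀ b ∈ LinearMap.range D.coboundary,
        (((D.gaugeSpace H ψ).projectionOnto _ hcompl (a + b) : D.gaugeSpace H ψ) : D.EdgeSpace)
          = a := by
      intro a ha b hb
      rw [map_add, Submodule.projectionOnto_apply_of_mem_left _ ha,
        Submodule.projectionOnto_apply_of_mem_right _ hb, add_zero]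
    have hdir : directSumForm hcompl ((2 : ℝ) • B.restrict (D.gaugeSpace H ψ)) 0 (z + u) (w + y) =
        2 * B z w := by
      simp only [directSumForm, LinearMap.add_apply, LinearMap.BilinForm.comp_apply,
        LinearMap.zero_apply, add_zero, LinearMap.smul_apply, smul_eq_mul,
        LinearMap.BilinForm.restrict_apply, LinearMap.domRestrict_apply]
      rw [hproj z hz u hu, hproj w hw y hy]
    rw [hdir, LinearMap.BilinForm.add_left, hgauge u hu, add_zero, LinearMap.BilinForm.add_right,
      hessian_symm hsmooth z y, hgauge y hy, add_zero, hpolar z hz w hw]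
  refine ⟨hsmooth, fderiv_eq_zero_of_even (D.magneticEigenvalue_neg hH k hk₁ hk),
    ⟨hcompl, hform⟩, ?_⟩
  have hadd := sigNeg_eq_add_of_isCompl B hcompl fun w hw u hu => by
    rw [D.gaugeSpace_eq_orthogonal hsupp hne, LinearMap.BilinForm.mem_orthogonal_iff] at hw
    have h1 : B u w = 0 := hw u hu
    exact ⟨(hBsymm.eq w u).trans h1, h1⟩
  rw [D.sigNeg_weight, D.sigNeg_weight_coboundary hH hsupp k hk₁ hk hlam hsimple hψ hne] at hadd
  rw [hform, morseIndex_directSumForm_two_smul]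
  -- The natural subtraction `k - 1` agrees with the integer one because `1 ≤ k`.
  omega
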